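/- For $x\in\{0,1\}^n$ let $\|x\|_1$ be its number of ones, let $x^*=(1,\dots,1)$, and let the $k$-th layer $L_k$ be the set of $x$ with $n-\|x\|_1=k$. The OI/OW Markov move-acceptance hyper-heuristic with parameters $p,q\in(0,1)$, maximizing $f\colon\{0,1\}^n\to\mathbb R$, starts with a uniformly random $x_0\in\{0,1\}^n$ and the operator $s_0=\mathrm{OI}$. In each iteration $t=0,1,2,\dots$ it obtains $x'$ from $x_t$ by flipping one uniformly random bit. If $s_t=\mathrm{OI}$, then $x_{t+1}=x'$ if $f(x')>f(x_t)$ and $x_{t+1}=x_t$ otherwise; if $s_t=\mathrm{OW}$, then $x_{t+1}=x'$ if $f(x')<f(x_t)$ and $x_{t+1}=x_t$ otherwise. Then, independently of everything else, the operator is switched, with probability $p$ if $s_t=\mathrm{OI}$ and with probability $q$ if $s_t=\mathrm{OW}$; this gives $s_{t+1}$. The runtime is $T=\inf\{t\ge 0 : x_t=x^*\}$. The benchmarks are: - $\mathrm{Jump}_m(x)=m+\|x\|_1$ if $\|x\|_1\in[0..n-m]\cup\{n\}$, and $n-\|x\|_1$ otherwise. - $\mathrm{Cliff}_d(x)=\|x\|_1$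 if $\|x\|_1\le n-d$, and $\|x\|_1-d+\frac12$ otherwise. - $\mathrm{CliffJump}_{d,r,s}(x)=\|x\|_1$ if $\|x\|_1\le n-d$; $n-2d+\frac32-s\,(\|x\|_1-(n-d+1))$ if $n-d<\|x\|_1\le n-d+r$; and $\|x\|_1-d+\frac12$ if $\|x\|_1>n-d+r$. For integers $n>d_1>d_2>0$ let $\mathrm{SEQOPT}_2(d_1,d_2)$ be the set of all $f\colon\{0,1\}^n\to\mathbb R$ that have $x^*$ as unique global maximum and such that, for all $h\in[0..n-1]$, $x\in L_h$ and $y\in L_{h+1}$: $f(x)>f(y)$ if $h\ge d_1$; $f(x)<f(y)$ if $d_2\le h<d_1$; and $f(x)>f(y)$ if $h<d_2$. Let $p=p_n$ and $q=q_n$ be in $(0,1)$ with $p=\Theta(\frac1{n\log n})$ and $q=\Theta(\frac1{n\log n})$ as $n\to\infty$. Then there are constants $C>0$ and $N$, depending only on the sequences $(p_n)$ and $(q_n)$, such that for all $n\ge N$ the runtime $T$ of the OI/OW Markov hyper-heuristic satisfies the following. 1. On $\mathrm{Jump}_m$, for every integer $m$ with $2\le m\le n/2$: $\ \mathrm E[T]\le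 C\,\frac{n^3}{m}\log n$. 2. On $\mathrm{Cliff}_d$, for every integer $d$ with $2\le d\le n/2$: $\ \mathrm E[T]\le C\,\frac{n^3}{d^2}\log n$. 3. On $\mathrm{CliffJump}_{d,r,s}$, for all integers $s\ge1$ and $1\le r<d\le n/2$: $\ \mathrm E[T]\le C\,\frac{n^3}{d(d-r)}\log n$. More generally, the same bound holds, with the same constants, on every $f\in\mathrm{SEQOPT}_2(d,d-r)$, that is, on every function with the CliffJump landscape: ascending up to layer $d$, descending over the next $r$ layers, and ascending from layer $d-r$ to the unique optimum. -/

import Mathlib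

open MeasureTheory ProbabilityTheory Filter Asymptotics
open scoped ENNReal unitInterval

namespace MMAHH

/-! ### Bit strings, layers and benchmark functions -/

/-- Bit strings of length `n`. -/
abbrev BitString (n : ℕ) : Type := Fin n → Bool

/-- The number of ones of a bit string. -/
def ones {n : ℕ} (x : BitString n) : ℕ := (Finset.univ.filter fun i => x i = true).card

/-- The all-ones string, the target of the optimization. -/
def allOnes (n : ℕ) : BitString n := fun _ => true

/-- The layer of strings at Hamming distance `k` from the all-ones string. -/
def layer (n k : ℕ) : Set (BitString n) := {x | hammingDist x (allOnes n) = k}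

/-- `Jump_m`. (For `m ≤ n`, `ones x + m ≤ n` says that `x` has at most `n - m` ones.) -/
noncomputable def jump (n m : ℕ) (x : BitString n) : ℝ :=
  if ones x + m ≤ n ∨ ones x = n then (m : ℝ) + ones x else (n : ℝ) - ones x

/-- `Cliff_d`. -/
noncomputable def cliff (n d : ℕ) (x : BitString n) : ℝ :=
  if ones x + d ≤ n then (ones x : ℝ) else (ones x : ℝ) - d + 1 / 2

/-- `CliffJump_{d,r,s}`: fitness `‖x‖₁` up to the local optimum with `n - d` ones; then a
cliff, followed by a valley in which the fitness descends with slope `s` until there are `n - d + r`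
ones; from there on the second slope of `Cliff_d` is followed up to the all-ones string. -/
noncomputable def cliffJump (n d r s : ℕ) (x : BitString n) : ℝ :=
  if ones x + d ≤ n then (ones x : ℝ)
  else if ones x + d ≤ n + r then
    ((n : ℝ) - d + 1) - d + 1 / 2 - s * ((ones x : ℝ) - (n - d + 1))
  else (ones x : ℝ) - d + 1 / 2

/-- `f` is increasing from layer `h + 1` to layer `h`. -/
def IncreasingAt {n : ℕ} (f : BitString n → ℝ) (h : ℕ) : Prop :=
  ∀ x ∈ layer n h, ∀ y ∈ layer n (h + 1), f y < f x

/-- `f` is decreasing from layer `h + 1` to layer `h`. -/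
def DecreasingAt {n : ℕ} (f : BitString n → ℝ) (h : ℕ) : Prop :=
  ∀ x ∈ layer n h, ∀ y ∈ layer n (h + 1), f x < f y

/-- Functions whose unique global maximum is the all-ones string and which, walking through the
layers from `n` down to `0`, increase from layer `n` to layer `d₁`, decrease from layer `d₁` to
layer `d₂` and increase from layer `d₂` to layer `0`. -/
structure IsSeqOptTwo {n : ℕ} (d₁ d₂ : ℕ) (f : BitString n → ℝ) : Prop where
  unique_max : ∀ x, x ≠ allOnes n → f x < f (allOnes n)
  first_ascent : ∀ h, d₁ ≤ h → h < n → IncreasingAt f h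
  descent : ∀ h, d₂ ≤ h → h < d₁ → DecreasingAt f h
  second_ascent : ∀ h, h < d₂ → IncreasingAt f h

/-! ### The Markov move-acceptance hyper-heuristic -/

/-- The acceptance operators only-improving and only-worsening. -/
inductive Op
  | OI
  | OW

/-- A state of the algorithm: the current solution and the current operator. -/
abbrev State (n : ℕ) : Type := BitString n × Op

/-- The random input of one iteration: the position to be flipped, the coin that decides whether
`OI` is left, and the coin that decides whether `OW` is left. -/
abbrev StepInput (n : ℕ) : Type := Fin n × Bool × Bool

/-- Flip the bit at position `i`. -/
def flip {n : ℕ} (x : BitString n) (i : Fin n) : BitString n := Function.update x i (!(x i))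

open Classical in
/-- The acceptance step, with parent `x` and offspring `x'`. -/
noncomputable def accept {n : ℕ} (f : BitString n → ℝ) (s : Op) (x x' : BitString n) :
    BitString n :=
  match s with
  | Op.OW => if f x' < f x then x' else x
  | Op.OI => if f x < f x' then x' else x

/-- One transition of the two-state chain of operators. -/
def nextOp (s : Op) (leaveOI leaveOW : Bool) : Op :=
  match s with
  | Op.OI => if leaveOI then Op.OW else Op.OI
  | Op.OW => if leaveOW then Op.OI else Op.OW

/-- One iteration of the algorithm. -/
noncomputable def step {n : ℕ} (f : BitString n → ℝ) (z : State n) (u : StepInput n) : State n :=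
  (accept f z.2 z.1 (flip z.1 u.1), nextOp z.2 u.2.1 u.2.2)

/-- The state at time `t` when the initial string is `x₀`, the initial operator is `OI`, and
iteration `t` uses the random input `u t`. -/
noncomputable def run {n : ℕ} (f : BitString n → ℝ) (x₀ : BitString n) (u : ℕ → StepInput n) :
    ℕ → State n
  | 0 => (x₀, Op.OI)
  | t + 1 => step f (run f x₀ u t) (u t)

/-- The first time at which the current solution is the all-ones string (`∞` if there is none). -/
noncomputable def runtime {n : ℕ} (f : BitString n → ℝ) (x₀ : BitString n)
    (u : ℕ → StepInput n) : ℝ≥0∞ :=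
  ⨅ (t : ℕ) (_ : (run f x₀ u t).1 = allOnes n), (t : ℝ≥0∞)

/-- The law of the random input of one iteration: a uniform position and independent coins of
parameters `p` (leave `OI`) and `q` (leave `OW`). -/
noncomputable def stepLaw (n : ℕ) [NeZero n] (p q : I) : Measure (StepInput n) :=
  (PMF.uniformOfFintype (Fin n)).toMeasure.prod
    ((bernoulliMeasure true false p).prod (bernoulliMeasure true false q))

/-- The law of all the randomness: a uniform initial string and independent inputs for all
iterations. -/
noncomputable def inputLaw (n : ℕ) [NeZero n] (p q : I) :
    Measure (BitString n × (ℕ → StepInput n)) :=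
  (PMF.uniformOfFintype (BitString n)).toMeasure.prod (Measure.infinitePi fun _ => stepLaw n p q)

/-- The expected runtime of the algorithm with switching probabilities `p` and `q` on `f`. -/
noncomputable def expectedRuntime {n : ℕ} [NeZero n] (p q : I) (f : BitString n → ℝ) : ℝ≥0∞ :=
  ∫⁻ ω, runtime f ω.1 ω.2 ∂(inputLaw n p q)

end MMAHH

/-! Only the layer and the operator matter, because every flip crosses one edge between layers and
the direction of that edge decides acceptance. In a favourable round, `OI` carries the search to the
local optimum in layer `d₁` and waits there. After the switch, the first flip must hit a zero, with
chance `d₁/n`, since a flipped one leads back up. `OW` then walks down to the valley bottom, layer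
`d₂`, and waits. After the next switch, the first flip must again hit a zero, with chance `d₂/n`,
and `OI` walks on to layer 0. A phase lasts about `n log n` steps, the coupon-collector scale, so
each walk is completed within its phase with at least constant probability `κ`. A round costs `1/p +
1/q` in expectation, which gives order `n² (1/p + 1/q) / (d₁ d₂)`.

This is proved by additive drift (`lintegral_hittingTime_le`) for the potential `potOI`, `potOW`.
The rewards `α`, `γ`, `M` stand for reaching layers `d₁`, `d₂` and 0. During a walk the reward is
multiplied by a factor `A h`, realised by `damping`, that pays for the risk of a switch before the
walk ends. The shifts `-β` and `-δ` charge for elapsed time. `expectedRuntime_le_of_damping` checks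
the drift layer by layer, `IsSeqOptTwo.expectedRuntime_le` chooses the rewards, and the benchmarks
are instances of `SEQOPT₂`. -/

namespace MMAHH

/-! ### Additive drift -/

section Drift

variable {S U : Type*}

/-- The trajectory of the random dynamical system `g` from `z` that is driven by `u`. -/
def trajectory (g : S → U → S) (z : S) (u : ℕ → U) : ℕ → S
  | 0 => z
  | t + 1 => g (trajectory g z u t) (u t)

lemma trajectory_congr (g : S → U → S) (z : S) {u v : ℕ → U} (t : ℕ) (h : ∀ i < t, u i = v i) :
    trajectory g z u t = trajectory g z v t := by
  induction t with
  | zero => rfl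
  | succ t ih =>
    simp only [trajectory]
    rw [ih fun i hi => h i (by omega), h t (by omega)]

variable [MeasurableSpace S] [MeasurableSpace U] [Countable U] [MeasurableSingletonClass U]

/-- The state at time `t` is a function of the inputs before `t` alone. -/
lemma indepFun_trajectory (μ : Measure U) [IsProbabilityMeasure μ] (g : S → U → S) (z : S)
    (t : ℕ) :
    IndepFun (fun u => trajectory g z u t) (fun u : ℕ → U => u t)
      (Measure.infinitePi fun _ => μ) := by
  classical
  obtain ⟨a⟩ : Nonempty U := nonempty_of_isProbabilityMeasure μ
  have hind : iIndepFun (fun (i : ℕ) (u : ℕ → U) => u i) (Measure.infinitePi fun _ => μ) :=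
    iIndepFun_infinitePi (P := fun _ => μ) (X := fun _ x => x) (fun _ => measurable_id)
  have h := hind.indepFun_finset (Finset.range t) {t} (by simp) (fun i => measurable_pi_apply i)
  -- The value `a` fills the inputs from time `t` on, which the state at time `t` never reads.
  have h2 := h.comp
    (φ := fun v => trajectory g z (fun i => if hi : i ∈ Finset.range t then v ⟨i, hi⟩ else a) t)
    (ψ := fun v => v ⟨t, by simp⟩) Measurable.of_discrete Measurable.of_discrete
  convert h2 using 1
  · funext u
    exact trajectory_congr g z t fun i hi => by simp [hi]
  · rfl

variable [Countable S] [MeasurableSingletonClass S]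

lemma measurable_trajectory (g : S → U → S) (z : S) (t : ℕ) :
    Measurable fun u => trajectory g z u t := by
  induction t with
  | zero => exact measurable_const
  | succ t ih =>
    exact (Measurable.of_discrete (f := fun w : S × U => g w.1 w.2)).comp
      (ih.prodMk (measurable_pi_apply t))

/-- The Markov property: by independence the joint law of state and fresh input is a product, so the
input can be integrated out first. -/
lemma lintegral_trajectory_succ (μ : Measure U) [IsProbabilityMeasure μ] (g : S → U → S) (z : S)
    (V : S → ℝ≥0∞) (t : ℕ) :
    ∫⁻ u, V (trajectory g z u (t + 1)) ∂(Measure.infinitePi fun _ => μ) =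
      ∫⁻ u, ∫⁻ w, V (g (trajectory g z u t) w) ∂μ ∂(Measure.infinitePi fun _ => μ) := by
  have hz := measurable_trajectory g z t
  have hmap := (indepFun_iff_map_prod_eq_prod_map_map hz.aemeasurable
    (measurable_pi_apply t).aemeasurable).1 (indepFun_trajectory μ g z t)
  calc ∫⁻ u, V (trajectory g z u (t + 1)) ∂(Measure.infinitePi fun _ => μ)
      = ∫⁻ y, V (g y.1 y.2) ∂((Measure.infinitePi fun _ => μ).map
          fun u => (trajectory g z u t, u t)) := by
        rw [lintegral_map Measurable.of_discrete (hz.prodMk (measurable_pi_apply t))]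
        rfl
    _ = ∫⁻ s, ∫⁻ w, V (g s w) ∂μ ∂((Measure.infinitePi fun _ => μ).map
          fun u => trajectory g z u t) := by
        rw [hmap, Measure.infinitePi_map_eval, lintegral_prod _ Measurable.of_discrete.aemeasurable]
    _ = _ := by
        rw [lintegral_map Measurable.of_discrete hz]

/-- Additive drift: if `V` decreases in expectation by at least the cost `c` in each step, then the
expected total cost is at most the initial value of `V`. -/
theorem lintegral_tsum_trajectory_le (μ : Measure U) [IsProbabilityMeasure μ] (g : S → U → S)
    (c V : S → ℝ≥0∞) (hV : ∀ s, ∫⁻ w, V (g s w) ∂μ + c s ≤ V s) (z : S) :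
    ∫⁻ u, ∑' t, c (trajectory g z u t) ∂(Measure.infinitePi fun _ => μ) ≤ V z := by
  have hm (f : S → ℝ≥0∞) (t : ℕ) : Measurable fun u : ℕ → U => f (trajectory g z u t) :=
    Measurable.of_discrete.comp (measurable_trajectory g z t)
  rw [lintegral_tsum fun t => (hm c t).aemeasurable]
  have key (N : ℕ) :
      ∑ t ∈ Finset.range N, ∫⁻ u, c (trajectory g z u t) ∂(Measure.infinitePi fun _ => μ)
        + ∫⁻ u, V (trajectory g z u N) ∂(Measure.infinitePi fun _ => μ) ≤ V z := by
    induction N with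
    | zero => simp [trajectory]
    | succ N ih =>
      refine le_trans ?_ ih
      rw [Finset.sum_range_succ, add_assoc, lintegral_trajectory_succ, add_comm (lintegral _ _),
        ← lintegral_add_right _ (hm c N)]
      gcongr
      exact hV _
  exact ENNReal.tsum_le_of_sum_range_le fun N => le_self_add.trans (key N)

/-- Additive drift for hitting times. -/
theorem lintegral_hittingTime_le (μ : Measure U) [IsProbabilityMeasure μ] (g : S → U → S)
    (P : S → Prop) (V : S → ℝ≥0∞) (hV : ∀ s, ¬ P s → ∫⁻ w, V (g s w) ∂μ + 1 ≤ V s) (z : S) :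
    ∫⁻ u, ⨅ (t : ℕ) (_ : P (trajectory g z u t)), (t : ℝ≥0∞) ∂(Measure.infinitePi fun _ => μ)
      ≤ V z := by
  classical
  -- The chain is frozen on `P`. Cost 1 off `P` and 0 on `P` then adds up to the hitting time, and
  -- the drift hypothesis is only needed off `P`.
  let g' : S → U → S := fun s w => if P s then s else g s w
  have htraj (u : ℕ → U) (k : ℕ) (hk : ∀ t < k, ¬ P (trajectory g z u t)) (t : ℕ) (ht : t ≤ k) :
      trajectory g' z u t = trajectory g z u t := by
    induction t with
    | zero => rfl
    | succ t ih => simp [trajectory, ih (by omega), g', hk t (by omega)]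
  refine le_trans (lintegral_mono fun u => ?_) (lintegral_tsum_trajectory_le μ g'
    (fun s => if P s then 0 else 1) V (fun s => ?_) z)
  · by_cases hex : ∃ t, P (trajectory g z u t)
    · refine (iInf₂_le (Nat.find hex) (Nat.find_spec hex)).trans ?_
      refine le_trans ?_ (ENNReal.sum_le_tsum (Finset.range (Nat.find hex)))
      rw [Finset.sum_congr rfl (g := fun _ => (1 : ℝ≥0∞))]
      · simp
      · intro t ht
        have ht' := Finset.mem_range.1 ht
        rw [htraj u _ (fun t h => Nat.find_min hex h) t ht'.le, if_neg (Nat.find_min hex ht')]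
    · push Not at hex
      have : ∀ t, (if P (trajectory g' z u t) then 0 else 1 : ℝ≥0∞) = 1 := fun t => by
        rw [htraj u t (fun s _ => hex s) t le_rfl, if_neg (hex t)]
      simp [this]
  · by_cases h : P s
    · simp [g', h]
    · simpa [g', h] using hV s h

end Drift

/-! ### One step of the algorithm, seen in the layers -/

instance : MeasurableSpace Op := ⊤

instance : DiscreteMeasurableSpace Op := ⟨fun _ => trivial⟩

instance : Finite Op :=
  Finite.of_injective (fun s : Op => match s with | .OI => true | .OW => false) fun s t h => by
    cases s <;> cases t <;> simp_all

lemma run_eq_trajectory {n : ℕ} (f : BitString n → ℝ) (x : BitString n) (u : ℕ → StepInput n)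
    (t : ℕ) : run f x u t = trajectory (step f) (x, Op.OI) u t := by
  induction t with
  | zero => rfl
  | succ t ih => simp only [run, trajectory, ih]

lemma hammingDist_allOnes {n : ℕ} (x : BitString n) :
    hammingDist x (allOnes n) = (Finset.univ.filter fun i => x i = false).card := by
  simp [hammingDist, allOnes]

lemma hammingDist_allOnes_le {n : ℕ} (x : BitString n) : hammingDist x (allOnes n) ≤ n := by
  simpa using hammingDist_le_card_fintype (x := x) (y := allOnes n)

lemma ones_add_hammingDist {n : ℕ} (x : BitString n) :
    ones x + hammingDist x (allOnes n) = n := by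
  have h := Finset.card_filter_add_card_filter_not (s := (Finset.univ : Finset (Fin n)))
    fun i => x i = true
  simpa [ones, hammingDist_allOnes] using h

lemma hammingDist_flip_of_false {n : ℕ} (x : BitString n) (i : Fin n) (hi : x i = false) :
    hammingDist (flip x i) (allOnes n) + 1 = hammingDist x (allOnes n) := by
  have h : (Finset.univ.filter fun j => x j = false)
      = insert i (Finset.univ.filter fun j => flip x i j = false) := by
    ext j
    by_cases hj : j = i <;> simp [flip, Function.update_apply, hj, hi]
  rw [hammingDist_allOnes, hammingDist_allOnes, h, Finset.card_insert_of_notMem]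
  simp [flip, hi]

lemma hammingDist_flip_of_true {n : ℕ} (x : BitString n) (i : Fin n) (hi : x i = true) :
    hammingDist (flip x i) (allOnes n) = hammingDist x (allOnes n) + 1 := by
  have h := hammingDist_flip_of_false (flip x i) i (by simp [flip, hi])
  have h2 : flip (flip x i) i = x := by simp [flip]
  rw [h2] at h
  exact h.symm

/-- The edge between the layers `h` and `h + 1` is one on which the fitness increases towards the
optimum. -/
def Ascends (d₁ d₂ h : ℕ) : Prop := h < d₂ ∨ d₁ ≤ h

instance (d₁ d₂ h : ℕ) : Decidable (Ascends d₁ d₂ h) := inferInstanceAs (Decidable (_ ∨ _))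

/-- The layer that `OI` reaches from layer `k + 1` if a zero is flipped. -/
def loOI (d₁ d₂ k : ℕ) : ℕ := if Ascends d₁ d₂ k then k else k + 1

/-- The layer that `OI` reaches from layer `h` if a one is flipped. -/
def hiOI (d₁ d₂ h : ℕ) : ℕ := if Ascends d₁ d₂ h then h else h + 1

/-- The layer that `OW` reaches from layer `k + 1` if a zero is flipped. -/
def loOW (d₁ d₂ k : ℕ) : ℕ := if Ascends d₁ d₂ k then k + 1 else k

/-- The layer that `OW` reaches from layer `h` if a one is flipped. -/
def hiOW (d₁ d₂ h : ℕ) : ℕ := if Ascends d₁ d₂ h then h + 1 else h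

/-! ### Effect of one iteration on the layer. -/

section Layers

variable {n d₁ d₂ : ℕ} {f : BitString n → ℝ}

lemma IsSeqOptTwo.lt_of_ascends (hf : IsSeqOptTwo d₁ d₂ f) {x y : BitString n} {h : ℕ}
    (hx : hammingDist x (allOnes n) = h) (hy : hammingDist y (allOnes n) = h + 1)
    (ha : Ascends d₁ d₂ h) : f y < f x := by
  have := hammingDist_allOnes_le y
  rcases ha with ha | ha
  · exact hf.second_ascent h ha x hx y hy
  · exact hf.first_ascent h ha (by omega) x hx y hy

lemma IsSeqOptTwo.lt_of_not_ascends (hf : IsSeqOptTwo d₁ d₂ f) {x y : BitString n} {h : ℕ}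
    (hx : hammingDist x (allOnes n) = h) (hy : hammingDist y (allOnes n) = h + 1)
    (ha : ¬ Ascends d₁ d₂ h) : f x < f y := by
  simp only [Ascends, not_or, not_lt, not_le] at ha
  exact hf.descent h ha.1 ha.2 x hx y hy

lemma hammingDist_accept_OI (hf : IsSeqOptTwo d₁ d₂ f) {x : BitString n} {k : ℕ}
    (hx : hammingDist x (allOnes n) = k + 1) (i : Fin n) :
    hammingDist (accept f Op.OI x (flip x i)) (allOnes n)
      = if x i = false then loOI d₁ d₂ k else hiOI d₁ d₂ (k + 1) := by
  by_cases hi : x i = false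
  · have hy : hammingDist (flip x i) (allOnes n) = k := by
      have := hammingDist_flip_of_false x i hi; omega
    by_cases ha : Ascends d₁ d₂ k
    · simp [accept, hi, loOI, ha, hf.lt_of_ascends hy hx ha, hy]
    · simp [accept, hi, loOI, ha, (hf.lt_of_not_ascends hy hx ha).not_gt, hx]
  · have hy : hammingDist (flip x i) (allOnes n) = k + 1 + 1 := by
      rw [hammingDist_flip_of_true x i (by simpa using hi), hx]
    by_cases ha : Ascends d₁ d₂ (k + 1)
    · simp [accept, hi, hiOI, ha, (hf.lt_of_ascends hx hy ha).not_gt, hx]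
    · simp [accept, hi, hiOI, ha, hf.lt_of_not_ascends hx hy ha, hy]

lemma hammingDist_accept_OW (hf : IsSeqOptTwo d₁ d₂ f) {x : BitString n} {k : ℕ}
    (hx : hammingDist x (allOnes n) = k + 1) (i : Fin n) :
    hammingDist (accept f Op.OW x (flip x i)) (allOnes n)
      = if x i = false then loOW d₁ d₂ k else hiOW d₁ d₂ (k + 1) := by
  by_cases hi : x i = false
  · have hy : hammingDist (flip x i) (allOnes n) = k := by
      have := hammingDist_flip_of_false x i hi; omega
    by_cases ha : Ascends d₁ d₂ k
    · simp [accept, hi, loOW, ha, (hf.lt_of_ascends hy hx ha).not_gt, hx]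
    · simp [accept, hi, loOW, ha, hf.lt_of_not_ascends hy hx ha, hy]
  · have hy : hammingDist (flip x i) (allOnes n) = k + 1 + 1 := by
      rw [hammingDist_flip_of_true x i (by simpa using hi), hx]
    by_cases ha : Ascends d₁ d₂ (k + 1)
    · simp [accept, hi, hiOW, ha, hf.lt_of_ascends hx hy ha, hy]
    · simp [accept, hi, hiOW, ha, (hf.lt_of_not_ascends hx hy ha).not_gt, hx]

/-- In layer `h` there are `h` zeros and `n - h` ones; this turns the average over positions into
the two-term form of the drift conditions. -/
lemma sum_ite_layer {x : BitString n} {h : ℕ} (hx : hammingDist x (allOnes n) = h)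
    (a b : ℝ) : ∑ i, (if x i = false then a else b) = h * a + ((n : ℝ) - h) * b := by
  have h1 := ones_add_hammingDist x
  rw [hx] at h1
  rw [hammingDist_allOnes] at hx
  have h2 : (Finset.univ.filter fun i => ¬ x i = false).card = ones x := by simp [ones]
  rw [Finset.sum_ite, Finset.sum_const, Finset.sum_const, hx, h2, nsmul_eq_mul, nsmul_eq_mul]
  congr 2
  rw [eq_sub_iff_add_eq]
  exact_mod_cast h1

end Layers

/-! ### From a potential on the layers to the expected runtime. -/

instance (n : ℕ) [NeZero n] (p q : I) : IsProbabilityMeasure (stepLaw n p q) := by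
  unfold stepLaw; infer_instance

lemma integral_stepLaw {n : ℕ} [NeZero n] (p q : I) (G : StepInput n → ℝ) :
    ∫ u, G u ∂(stepLaw n p q) = (∑ i,
      ((p : ℝ) * ((q : ℝ) * G (i, true, true) + (1 - q) * G (i, true, false))
        + (1 - p) * ((q : ℝ) * G (i, false, true) + (1 - q) * G (i, false, false)))) / n := by
  have hint : Integrable G (stepLaw n p q) := .of_finite
  unfold stepLaw at hint ⊢
  rw [integral_prod _ hint, PMF.integral_eq_sum, Finset.sum_div]
  refine Finset.sum_congr rfl fun i _ => ?_
  rw [integral_prod _ .of_finite, integral_bernoulliMeasure, integral_bernoulliMeasure,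
    integral_bernoulliMeasure]
  simp only [PMF.uniformOfFintype_apply, Fintype.card_fin, ENNReal.toReal_inv,
    ENNReal.toReal_natCast, smul_eq_mul]
  ring

/-- The bound on the expected runtime that a potential function on the layers gives: `φ` and `ψ` are
the potentials under `OI` and `OW`, which grow in expectation by at least one in each step. -/
theorem expectedRuntime_le_of_potential {n : ℕ} [NeZero n] {d₁ d₂ : ℕ} {f : BitString n → ℝ}
    (hf : IsSeqOptTwo d₁ d₂ f) (p q : I) {M : ℝ} (φ ψ : ℕ → ℝ) (hφ : ∀ h ≤ n, 0 ≤ φ h)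
    (hφM : ∀ h, φ h ≤ M) (hψM : ∀ h, ψ h ≤ M)
    (hOI : ∀ k, k + 1 ≤ n → φ (k + 1) + 1 ≤
      (1 - p) * (((k + 1 : ℕ) * φ (loOI d₁ d₂ k)
          + ((n : ℝ) - (k + 1 : ℕ)) * φ (hiOI d₁ d₂ (k + 1))) / n)
        + p * (((k + 1 : ℕ) * ψ (loOI d₁ d₂ k)
          + ((n : ℝ) - (k + 1 : ℕ)) * ψ (hiOI d₁ d₂ (k + 1))) / n))
    (hOW : ∀ k, k + 1 ≤ n → ψ (k + 1) + 1 ≤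
      (1 - q) * (((k + 1 : ℕ) * ψ (loOW d₁ d₂ k)
          + ((n : ℝ) - (k + 1 : ℕ)) * ψ (hiOW d₁ d₂ (k + 1))) / n)
        + q * (((k + 1 : ℕ) * φ (loOW d₁ d₂ k)
          + ((n : ℝ) - (k + 1 : ℕ)) * φ (hiOW d₁ d₂ (k + 1))) / n)) :
    expectedRuntime p q f ≤ ENNReal.ofReal M := by
  have hn : (n : ℝ) ≠ 0 := by simp [NeZero.ne n]
  let pot : Op → ℕ → ℝ := fun s h => match s with | .OI => φ h | .OW => ψ h
  have hpot : ∀ s h, pot s h ≤ M := fun s h => by cases s <;> simp [pot, hφM, hψM]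
  let V : State n → ℝ := fun z => M - pot z.2 (hammingDist z.1 (allOnes n))
  have hV0 : ∀ z, 0 ≤ V z := fun z => sub_nonneg.2 (hpot _ _)
  have hdrift : ∀ z : State n, ¬ z.1 = allOnes n →
      ∫⁻ u, ENNReal.ofReal (V (step f z u)) ∂(stepLaw n p q) + 1 ≤ ENNReal.ofReal (V z) := by
    rintro ⟨x, s⟩ hx
    rw [← ofReal_integral_eq_lintegral_ofReal .of_finite (ae_of_all _ fun u => hV0 _),
      ← ENNReal.ofReal_one, ← ENNReal.ofReal_add (integral_nonneg fun u => hV0 _) zero_le_one]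
    refine ENNReal.ofReal_le_ofReal ?_
    obtain ⟨k, hk⟩ : ∃ k, hammingDist x (allOnes n) = k + 1 :=
      Nat.exists_eq_succ_of_ne_zero (hammingDist_ne_zero.2 hx)
    have hkn : k + 1 ≤ n := hk ▸ hammingDist_allOnes_le x
    rw [integral_stepLaw]
    cases s with
    | OI =>
      have h := hOI k hkn
      rw [← sum_ite_layer hk, ← sum_ite_layer hk] at h
      have e : ∀ i, (p : ℝ) * ((q : ℝ) * V (step f (x, Op.OI) (i, true, true))
            + (1 - q) * V (step f (x, Op.OI) (i, true, false)))
          + (1 - p) * ((q : ℝ) * V (step f (x, Op.OI) (i, false, true))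
            + (1 - q) * V (step f (x, Op.OI) (i, false, false)))
          = M - ((1 - p) * (if x i = false then φ (loOI d₁ d₂ k) else φ (hiOI d₁ d₂ (k + 1)))
            + p * (if x i = false then ψ (loOI d₁ d₂ k) else ψ (hiOI d₁ d₂ (k + 1)))) := by
        intro i
        simp only [V, step, nextOp, pot, hammingDist_accept_OI hf hk, Bool.false_eq_true, if_true,
          if_false]
        split_ifs <;> ring
      simp only [e, Finset.sum_sub_distrib, Finset.sum_add_distrib, ← Finset.mul_sum]
      simp only [V, pot, hk, Finset.sum_const, Finset.card_univ, Fintype.card_fin, nsmul_eq_mul]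
      rw [sub_div, mul_div_cancel_left₀ _ hn, add_div, mul_div_assoc, mul_div_assoc]
      linarith
    | OW =>
      have h := hOW k hkn
      rw [← sum_ite_layer hk, ← sum_ite_layer hk] at h
      have e : ∀ i, (p : ℝ) * ((q : ℝ) * V (step f (x, Op.OW) (i, true, true))
            + (1 - q) * V (step f (x, Op.OW) (i, true, false)))
          + (1 - p) * ((q : ℝ) * V (step f (x, Op.OW) (i, false, true))
            + (1 - q) * V (step f (x, Op.OW) (i, false, false)))
          = M - ((1 - q) * (if x i = false then ψ (loOW d₁ d₂ k) else ψ (hiOW d₁ d₂ (k + 1)))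
            + q * (if x i = false then φ (loOW d₁ d₂ k) else φ (hiOW d₁ d₂ (k + 1)))) := by
        intro i
        simp only [V, step, nextOp, pot, hammingDist_accept_OW hf hk, Bool.false_eq_true, if_true,
          if_false]
        split_ifs <;> ring
      simp only [e, Finset.sum_sub_distrib, Finset.sum_add_distrib, ← Finset.mul_sum]
      simp only [V, pot, hk, Finset.sum_const, Finset.card_univ, Fintype.card_fin, nsmul_eq_mul]
      rw [sub_div, mul_div_cancel_left₀ _ hn, add_div, mul_div_assoc, mul_div_assoc]
      linarith
  have hstart (x : BitString n) :
      ∫⁻ u, runtime f x u ∂(Measure.infinitePi fun _ => stepLaw n p q) ≤ ENNReal.ofReal M := by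
    have h := lintegral_hittingTime_le (stepLaw n p q) (step f) (fun z => z.1 = allOnes n)
      (fun z => ENNReal.ofReal (V z)) hdrift (x, Op.OI)
    simp only [runtime, run_eq_trajectory]
    refine h.trans (ENNReal.ofReal_le_ofReal ?_)
    simpa [V, pot] using hφ _ (hammingDist_allOnes_le x)
  -- The inequality `lintegral_prod_le` suffices here and asks for no measurability of `runtime`.
  calc expectedRuntime p q f
      ≤ ∫⁻ x, ∫⁻ u, runtime f x u ∂(Measure.infinitePi fun _ => stepLaw n p q)
          ∂(PMF.uniformOfFintype (BitString n)).toMeasure := lintegral_prod_le _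
    _ ≤ ∫⁻ _, ENNReal.ofReal M ∂(PMF.uniformOfFintype (BitString n)).toMeasure :=
        lintegral_mono hstart
    _ = ENNReal.ofReal M := by simp

/-! ### The potential function -/

/-- The potential under `OI`. -/
noncomputable def potOI (A : ℕ → ℝ) (M α β γ : ℝ) (n d₁ d₂ h : ℕ) : ℝ :=
  if h = 0 then M
  else if h < d₂ then M * A h - β
  else if h = d₂ then γ
  else if h < d₁ then α * A (n - h) - β
  else if h = d₁ then α - β
  else α * A h - β

/-- The potential under `OW`. -/
noncomputable def potOW (A : ℕ → ℝ) (M α γ δ : ℝ) (d₁ d₂ h : ℕ) : ℝ :=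
  if h = 0 then M
  else if h < d₂ then -δ
  else if h = d₂ then γ - δ
  else if h < d₁ then γ * A h - δ
  else if h = d₁ then α - δ
  else -δ

/-! ### Upper and lower bounds for the potentials. -/

section Bounds

variable {A : ℕ → ℝ} {M α β γ δ κ : ℝ} {n d₁ d₂ : ℕ}

/-- Even the smallest damped reward covers the time charge `β`. Hence a switch from `OW` to `OI` is
worth at least 0 in every layer, so a failed round can simply be written off. -/
lemma potOI_nonneg (hκA : ∀ h, κ ≤ A h) (hA1 : ∀ h, A h ≤ 1) (hα : 0 ≤ α)
    (hγ : 0 ≤ γ) (hM : 0 ≤ M) (hακ : β ≤ α * κ) (hMκ : β ≤ M * κ) (h : ℕ) :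
    0 ≤ potOI A M α β γ n d₁ d₂ h := by
  have h1 (j : ℕ) : β ≤ α * A j := hακ.trans (mul_le_mul_of_nonneg_left (hκA j) hα)
  have h2 (j : ℕ) : β ≤ M * A j := hMκ.trans (mul_le_mul_of_nonneg_left (hκA j) hM)
  have h3 : α * A 0 ≤ α := mul_le_of_le_one_right hα (hA1 0)
  unfold potOI
  split_ifs
  · exact hM
  · linarith [h2 h]
  · exact hγ
  · linarith [h1 (n - h)]
  · linarith [h1 0]
  · linarith [h1 h]

lemma potOI_le (hA1 : ∀ h, A h ≤ 1) (hβ : 0 ≤ β) (hα : 0 ≤ α) (hM : 0 ≤ M) (hαM : α ≤ M)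
    (hγM : γ ≤ M) (h : ℕ) : potOI A M α β γ n d₁ d₂ h ≤ M := by
  have h1 (j : ℕ) : α * A j ≤ α := mul_le_of_le_one_right hα (hA1 j)
  have h2 (j : ℕ) : M * A j ≤ M := mul_le_of_le_one_right hM (hA1 j)
  unfold potOI
  split_ifs
  · exact le_rfl
  · linarith [h2 h]
  · exact hγM
  · linarith [h1 (n - h)]
  · linarith
  · linarith [h1 h]

lemma neg_le_potOW (hA0 : ∀ h, 0 ≤ A h) (hα : 0 ≤ α) (hγ : 0 ≤ γ) (hM : 0 ≤ M) (hδ : 0 ≤ δ)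
    (h : ℕ) : -δ ≤ potOW A M α γ δ d₁ d₂ h := by
  have h1 := mul_nonneg hγ (hA0 h)
  unfold potOW
  split_ifs <;> linarith

lemma potOW_le (hA1 : ∀ h, A h ≤ 1) (hγ : 0 ≤ γ) (hM : 0 ≤ M) (hδ : 0 ≤ δ) (hαM : α ≤ M)
    (hγM : γ ≤ M) (h : ℕ) : potOW A M α γ δ d₁ d₂ h ≤ M := by
  have h1 : γ * A h ≤ γ := mul_le_of_le_one_right hγ (hA1 h)
  unfold potOW
  split_ifs <;> linarith

end Bounds

/-- The drift inequality under the operator that is left with probability `r`, when all values are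
shifted by `b` and `b'`, where `1 + r * b' = r * b`. -/
lemma drift_of_shifted {r N w b b' X x₁ x₂ y₁ y₂ a₁ a₂ c₁ c₂ : ℝ} (hr0 : 0 ≤ r) (hr1 : r ≤ 1)
    (hN : 0 < N) (hw0 : 0 ≤ w) (hwN : w ≤ N) (hb : 1 + r * b' = r * b)
    (hx₁ : a₁ - b ≤ x₁) (hx₂ : a₂ - b ≤ x₂) (hy₁ : c₁ - b' ≤ y₁) (hy₂ : c₂ - b' ≤ y₂)
    (hX : X ≤ (1 - r) * ((w * a₁ + (N - w) * a₂) / N) + r * ((w * c₁ + (N - w) * c₂) / N)) :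
    X - b + 1 ≤ (1 - r) * ((w * x₁ + (N - w) * x₂) / N) + r * ((w * y₁ + (N - w) * y₂) / N) := by
  have h1 : (w * a₁ + (N - w) * a₂) / N - b ≤ (w * x₁ + (N - w) * x₂) / N := by
    rw [div_sub' hN.ne', div_le_div_iff_of_pos_right hN]
    nlinarith [mul_le_mul_of_nonneg_left hx₁ hw0,
      mul_le_mul_of_nonneg_left hx₂ (sub_nonneg.2 hwN)]
  have h2 : (w * c₁ + (N - w) * c₂) / N - b' ≤ (w * y₁ + (N - w) * y₂) / N := by
    rw [div_sub' hN.ne', div_le_div_iff_of_pos_right hN]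
    nlinarith [mul_le_mul_of_nonneg_left hy₁ hw0,
      mul_le_mul_of_nonneg_left hy₂ (sub_nonneg.2 hwN)]
  -- The shifts contribute `-(1 - r) * b - r * b' = 1 - b`, which supplies the required gain of one.
  have h3 := mul_le_mul_of_nonneg_left h1 (sub_nonneg.2 hr1)
  have h4 := mul_le_mul_of_nonneg_left h2 hr0
  linarith

/-- The runtime bound from a sequence `A` of damping factors that compensates for leaving the
operator at rate `p` or `q`. -/
theorem expectedRuntime_le_of_damping {n : ℕ} [NeZero n] {d₁ d₂ : ℕ} {f : BitString n → ℝ}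
    (hf : IsSeqOptTwo d₁ d₂ f) (hd₂ : 0 < d₂) (hd : d₂ < d₁) (hd₁ : d₁ < n) (p q : I)
    (hp0 : 0 < (p : ℝ)) (hp : (p : ℝ) ≤ 1 / 2) (hq0 : 0 < (q : ℝ)) (hq : (q : ℝ) ≤ 1 / 2)
    {A : ℕ → ℝ} {M α β γ κ : ℝ} (hβ : β = 1 / (p : ℝ) + 1 / (q : ℝ))
    (hκ : 0 ≤ κ) (hκA : ∀ h, κ ≤ A h) (hA1 : ∀ h, A h ≤ 1)
    (hA : ∀ r : ℝ, (r = p ∨ r = q) → ∀ k, k + 1 ≤ n → A (k + 1) ≤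
      (1 - r) * (((k + 1 : ℕ) * A k + ((n : ℝ) - (k + 1 : ℕ)) * A (k + 1)) / n))
    (hα : 0 ≤ α) (hακ : β ≤ α * κ) (hαγ : α ≤ γ) (hγM : γ ≤ M)
    (hγα : α ≤ 1 / 2 * (d₁ / n * (γ * κ))) (hMγ : γ + β ≤ 1 / 2 * (d₂ / n * (M * κ))) :
    expectedRuntime p q f ≤ ENNReal.ofReal M := by
  have hn : (0 : ℝ) < n := by simp [NeZero.pos n]
  have hγ : 0 ≤ γ := hα.trans hαγ
  have hM : 0 ≤ M := hγ.trans hγM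
  have hδ : 0 ≤ 1 / (q : ℝ) := by positivity
  have hβ0 : 0 ≤ β := by rw [hβ]; positivity
  have hA0 : ∀ h, 0 ≤ A h := fun h => hκ.trans (hκA h)
  have hMκ : β ≤ M * κ := hακ.trans (by gcongr; exact hαγ.trans hγM)
  have hαA (j : ℕ) : α * A j ≤ α := mul_le_of_le_one_right hα (hA1 j)
  have hγA (j : ℕ) : γ * A j ≤ γ := mul_le_of_le_one_right hγ (hA1 j)
  have hMA (j : ℕ) : M * A j ≤ M := mul_le_of_le_one_right hM (hA1 j)
  have hφ0 := fun h => potOI_nonneg (n := n) (d₁ := d₁) (d₂ := d₂) hκA hA1 hα hγ hM hακ hMκ h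
  have hψ0 := fun h => neg_le_potOW (d₁ := d₁) (d₂ := d₂) hA0 hα hγ hM hδ h
  -- The charges are mean waiting times: `1/q` until `OW` is left, and `β = 1/p + 1/q` for an `OI`
  -- phase followed by an `OW` phase.
  have hbp : 1 + (p : ℝ) * (1 / q) = p * β := by rw [hβ]; field_simp
  have hbq : 1 + (q : ℝ) * 0 = q * (1 / q) := by field_simp; simp
  refine expectedRuntime_le_of_potential hf p q (potOI A M α β γ n d₁ d₂)
    (potOW A M α γ (1 / q) d₁ d₂) (fun h _ => hφ0 h)
    (potOI_le hA1 hβ0 hα hM (hαγ.trans hγM) hγM) (potOW_le hA1 hγ hM hδ (hαγ.trans hγM) hγM)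
    (fun k hk => ?_) fun k hk => ?_
  · have hkn : ((k + 1 : ℕ) : ℝ) ≤ n := by exact_mod_cast hk
    have drift := @drift_of_shifted p n (k + 1 : ℕ) β (1 / q)
    rcases lt_trichotomy (k + 1) d₂ with hlt | heq | hgt
    · have e : potOI A M α β γ n d₁ d₂ (k + 1) = M * A (k + 1) - β := by
        simp [potOI, hlt]
      have e1 : loOI d₁ d₂ k = k := if_pos (Or.inl (by omega))
      have e2 : hiOI d₁ d₂ (k + 1) = k + 1 := if_pos (Or.inl hlt)
      rw [e1, e2]
      conv_lhs => rw [e]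
      refine drift (a₁ := M * A k) (a₂ := M * A (k + 1)) (c₁ := 0) (c₂ := 0) hp0.le p.2.2 hn
        (by positivity) hkn hbp ?_ e.ge (by simpa using hψ0 k) (by simpa using hψ0 (k + 1)) ?_
      · unfold potOI
        split_ifs <;> first | omega | linarith [hMA k]
      · have := mul_le_mul_of_nonneg_left (hA p (Or.inl rfl) k hk) hM
        refine this.trans (le_of_eq ?_)
        ring
    -- At the valley bottom `OI` accepts every flip. Only the flip of a zero without a switch is
    -- credited; the factor `1/2` in `hMγ` bounds `1 - p` from below.
    · have e : potOI A M α β γ n d₁ d₂ (k + 1) = (γ + β) - β := by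
        simp [potOI, heq, hd₂.ne']
      have e1 : loOI d₁ d₂ k = k := if_pos (Or.inl (by omega))
      have e2 : hiOI d₁ d₂ (k + 1) = k + 1 + 1 := if_neg (by simp only [Ascends]; omega)
      rw [e1, e2]
      conv_lhs => rw [e]
      refine drift (a₁ := M * A k) (a₂ := 0) (c₁ := 0) (c₂ := 0) hp0.le p.2.2 hn
        (by positivity) hkn hbp ?_ (by linarith [hφ0 (k + 1 + 1)]) (by simpa using hψ0 k)
        (by simpa using hψ0 (k + 1 + 1)) ?_
      · unfold potOI
        split_ifs <;> first | omega | linarith [hMA k]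
      · refine hMγ.trans ?_
        calc 1 / 2 * (d₂ / n * (M * κ)) ≤ (1 - p) * (d₂ / n * (M * A k)) := by
              gcongr
              · linarith
              · linarith
              · exact hκA k
          _ = _ := by rw [heq]; ring
    · rcases lt_trichotomy (k + 1) d₁ with hlt1 | heq1 | hgt1
      -- Inside the valley `OI` climbs back to layer `d₁` by flipping ones, so the damping is
      -- indexed by the number of ones.
      · have e : potOI A M α β γ n d₁ d₂ (k + 1) = α * A (n - (k + 1)) - β := by
          simp [potOI, hgt.not_gt, hgt.ne', hlt1]
        have e1 : loOI d₁ d₂ k = k + 1 := if_neg (by simp only [Ascends]; omega)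
        have e2 : hiOI d₁ d₂ (k + 1) = k + 1 + 1 := if_neg (by simp only [Ascends]; omega)
        rw [e1, e2]
        conv_lhs => rw [e]
        refine drift (a₁ := α * A (n - (k + 1))) (a₂ := α * A (n - (k + 1 + 1))) (c₁ := 0)
          (c₂ := 0) hp0.le p.2.2 hn
          (by positivity) hkn hbp e.ge ?_ (by simpa using hψ0 (k + 1))
          (by simpa using hψ0 (k + 1 + 1)) ?_
        · unfold potOI
          split_ifs <;> first | omega | linarith [hαA (n - (k + 1 + 1))]
        · have hn2 : n - (k + 1 + 1) + 1 = n - (k + 1) := by omega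
          have := mul_le_mul_of_nonneg_left (hA p (Or.inl rfl) (n - (k + 1 + 1)) (by omega)) hα
          rw [hn2, Nat.cast_sub hk] at this
          refine this.trans (le_of_eq ?_)
          ring
      -- At the local optimum `OI` rejects every flip. The reward `α` survives the switch, so
      -- waiting costs time but no damping.
      · have e : potOI A M α β γ n d₁ d₂ (k + 1) = α - β := by
          simp [potOI, heq1, hd.not_gt, hd.ne', show d₁ ≠ 0 by omega]
        have e' : potOW A M α γ (1 / q) d₁ d₂ (k + 1) = α - 1 / q := by
          simp [potOW, heq1, hd.not_gt, hd.ne', show d₁ ≠ 0 by omega]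
        have e1 : loOI d₁ d₂ k = k + 1 := if_neg (by simp only [Ascends]; omega)
        have e2 : hiOI d₁ d₂ (k + 1) = k + 1 := if_pos (Or.inr heq1.ge)
        rw [e1, e2]
        conv_lhs => rw [e]
        refine drift (a₁ := α) (a₂ := α) (c₁ := α) (c₂ := α) hp0.le p.2.2 hn
          (by positivity) hkn hbp e.ge e.ge e'.ge e'.ge (le_of_eq ?_)
        field_simp
        ring
      · have e : potOI A M α β γ n d₁ d₂ (k + 1) = α * A (k + 1) - β := by
          simp [potOI, hgt.not_gt, hgt.ne', hgt1.not_gt, hgt1.ne']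
        have e1 : loOI d₁ d₂ k = k := if_pos (Or.inr (by omega))
        have e2 : hiOI d₁ d₂ (k + 1) = k + 1 := if_pos (Or.inr hgt1.le)
        rw [e1, e2]
        conv_lhs => rw [e]
        refine drift (a₁ := α * A k) (a₂ := α * A (k + 1)) (c₁ := 0) (c₂ := 0) hp0.le p.2.2 hn
          (by positivity) hkn hbp ?_ e.ge (by simpa using hψ0 k) (by simpa using hψ0 (k + 1)) ?_
        · unfold potOI
          split_ifs <;> first | omega | linarith [hαA k]
        · have := mul_le_mul_of_nonneg_left (hA p (Or.inl rfl) k hk) hα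
          refine this.trans (le_of_eq ?_)
          ring
  · have hkn : ((k + 1 : ℕ) : ℝ) ≤ n := by exact_mod_cast hk
    have hφ0' : ∀ h, 0 - 0 ≤ potOI A M α β γ n d₁ d₂ h := by simpa using hφ0
    have hψ0' : ∀ h, 0 - 1 / (q : ℝ) ≤ potOW A M α γ (1 / q) d₁ d₂ h := by simpa using hψ0
    have drift := @drift_of_shifted q n (k + 1 : ℕ) (1 / q) 0
    rcases lt_trichotomy (k + 1) d₂ with hlt | heq | hgt
    · have e : potOW A M α γ (1 / q) d₁ d₂ (k + 1) = 0 - 1 / q := by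
        simp [potOW, hlt]
      conv_lhs => rw [e]
      exact drift (a₁ := 0) (a₂ := 0) (c₁ := 0) (c₂ := 0) hq0.le q.2.2 hn
        (by positivity) hkn hbq (hψ0' _) (hψ0' _) (hφ0' _) (hφ0' _) (by simp)
    -- The valley bottom is a local minimum: `OW` stays there until the switch and keeps the reward
    -- `γ`.
    · have e : potOW A M α γ (1 / q) d₁ d₂ (k + 1) = γ - 1 / q := by
        simp [potOW, heq, hd₂.ne']
      have e' : γ - 0 ≤ potOI A M α β γ n d₁ d₂ (k + 1) := by
        simp [potOI, heq, hd₂.ne']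
      have e1 : loOW d₁ d₂ k = k + 1 := if_pos (Or.inl (by omega))
      have e2 : hiOW d₁ d₂ (k + 1) = k + 1 := if_neg (by simp only [Ascends]; omega)
      rw [e1, e2]
      conv_lhs => rw [e]
      refine drift (a₁ := γ) (a₂ := γ) (c₁ := γ) (c₂ := γ) hq0.le q.2.2 hn
        (by positivity) hkn hbq e.ge e.ge e' e' (le_of_eq ?_)
      field_simp
      ring
    · rcases lt_trichotomy (k + 1) d₁ with hlt1 | heq1 | hgt1
      · have e : potOW A M α γ (1 / q) d₁ d₂ (k + 1) = γ * A (k + 1) - 1 / q := by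
          simp [potOW, hgt.not_gt, hgt.ne', hlt1]
        have e1 : loOW d₁ d₂ k = k := if_neg (by simp only [Ascends]; omega)
        have e2 : hiOW d₁ d₂ (k + 1) = k + 1 := if_neg (by simp only [Ascends]; omega)
        rw [e1, e2]
        conv_lhs => rw [e]
        refine drift (a₁ := γ * A k) (a₂ := γ * A (k + 1)) (c₁ := 0) (c₂ := 0) hq0.le q.2.2 hn
          (by positivity) hkn hbq ?_ e.ge (hφ0' _) (hφ0' _) ?_
        · unfold potOW
          split_ifs <;> first | omega | linarith [hγA k]
        · have := mul_le_mul_of_nonneg_left (hA q (Or.inr rfl) k hk) hγ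
          refine this.trans (le_of_eq ?_)
          ring
      -- `OW` leaves the local optimum at once, in either direction; only the entry into the valley,
      -- of probability `d₁/n`, is credited.
      · have e : potOW A M α γ (1 / q) d₁ d₂ (k + 1) = α - 1 / q := by
          simp [potOW, heq1, hd.not_gt, hd.ne', show d₁ ≠ 0 by omega]
        have e1 : loOW d₁ d₂ k = k := if_neg (by simp only [Ascends]; omega)
        rw [e1]
        conv_lhs => rw [e]
        refine drift (a₁ := γ * A k) (a₂ := 0) (c₁ := 0) (c₂ := 0) hq0.le q.2.2 hn
          (by positivity) hkn hbq ?_ (hψ0' _) (hφ0' _) (hφ0' _) ?_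
        · unfold potOW
          split_ifs <;> first | omega | linarith [hγA k]
        · refine hγα.trans ?_
          calc 1 / 2 * (d₁ / n * (γ * κ)) ≤ (1 - q) * (d₁ / n * (γ * A k)) := by
                gcongr
                · linarith
                · linarith
                · exact hκA k
            _ = _ := by rw [heq1]; ring
      · have e : potOW A M α γ (1 / q) d₁ d₂ (k + 1) = 0 - 1 / q := by
          simp [potOW, hgt.not_gt, hgt.ne', hgt1.not_gt, hgt1.ne']
        conv_lhs => rw [e]
        exact drift (a₁ := 0) (a₂ := 0) (c₁ := 0) (c₂ := 0) hq0.le q.2.2 hn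
          (by positivity) hkn hbq (hψ0' _) (hψ0' _) (hφ0' _) (hφ0' _) (by simp)

/-! ### The runtime bound on `SEQOPT₂` -/

/-- A product of damping factors, constant from `n` on. -/
noncomputable def damping (n : ℕ) (c : ℝ) (h : ℕ) : ℝ :=
  ∏ j ∈ Finset.range (min h n), (1 + c / ((j : ℝ) + 1))⁻¹

lemma damping_le_one (n : ℕ) {c : ℝ} (hc : 0 ≤ c) (h : ℕ) : damping n c h ≤ 1 :=
  Finset.prod_le_one (fun j _ => by positivity) fun j _ =>
    inv_le_one_of_one_le₀ (le_add_of_nonneg_right (by positivity))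

/-- Each factor is at least `exp (-c / (j + 1))`, and the harmonic sum up to `n` is at most `1 + log
n`. For `c` of order `1 / log n` the bound is a positive constant. -/
lemma exp_le_damping (n : ℕ) {c : ℝ} (hc : 0 ≤ c) (h : ℕ) :
    Real.exp (-(c * (1 + Real.log n))) ≤ damping n c h := by
  have hharm : ((harmonic (min h n) : ℚ) : ℝ) ≤ 1 + Real.log n := by
    refine le_trans ?_ (harmonic_le_one_add_log n)
    unfold harmonic
    exact_mod_cast Finset.sum_le_sum_of_subset_of_nonneg
      (Finset.range_mono (min_le_right h n)) fun j _ _ => by positivity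
  calc Real.exp (-(c * (1 + Real.log n)))
      ≤ Real.exp (-(c * (harmonic (min h n) : ℚ))) := by gcongr
    _ = ∏ j ∈ Finset.range (min h n), Real.exp (-(c / ((j : ℝ) + 1))) := by
        rw [← Real.exp_sum]
        congr 1
        simp [harmonic, Finset.mul_sum, div_eq_mul_inv]
    _ ≤ damping n c h := by
        refine Finset.prod_le_prod (fun j _ => (Real.exp_pos _).le) fun j _ => ?_
        rw [Real.exp_neg]
        have : 0 ≤ c / ((j : ℝ) + 1) := by positivity
        gcongr
        linarith [Real.add_one_le_exp (c / ((j : ℝ) + 1))]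

lemma damping_succ {n k : ℕ} (hk : k + 1 ≤ n) {c : ℝ} (hc : 0 ≤ c) :
    ((k + 1 : ℕ) : ℝ) * damping n c k = ((k + 1 : ℕ) + c) * damping n c (k + 1) := by
  have h : damping n c (k + 1) = damping n c k * (1 + c / ((k : ℝ) + 1))⁻¹ := by
    unfold damping
    rw [min_eq_left hk, min_eq_left (by omega), Finset.prod_range_succ]
  have h1 : (k : ℝ) + 1 + c ≠ 0 := by positivity
  have h2 : (k : ℝ) + 1 ≠ 0 := by positivity
  rw [h]
  push_cast
  rw [one_add_div h2, inv_div]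
  field_simp

/-- By `damping_succ` with `c = 2nρ`, averaging over the flipped bit multiplies the damping by
exactly `1 + 2ρ`. This outweighs the loss, as `(1 - ρ)(1 + 2ρ) = 1 + ρ(1 - 2ρ) ≥ 1`. -/
lemma damping_drift {n k : ℕ} (hk : k + 1 ≤ n) {r ρ : ℝ} (hr : r ≤ ρ) (hρ0 : 0 ≤ ρ)
    (hρ : ρ ≤ 1 / 2) :
    damping n (2 * n * ρ) (k + 1) ≤
      (1 - r) * (((k + 1 : ℕ) * damping n (2 * n * ρ) k
        + ((n : ℝ) - (k + 1 : ℕ)) * damping n (2 * n * ρ) (k + 1)) / n) := by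
  have hn : (0 : ℝ) < n := by exact_mod_cast (show 0 < n by omega)
  have hc : 0 ≤ 2 * n * ρ := by positivity
  have hpos : 0 ≤ damping n (2 * n * ρ) (k + 1) :=
    (Real.exp_pos _).le.trans (exp_le_damping n hc _)
  have e : ((k + 1 : ℕ) * damping n (2 * n * ρ) k
        + ((n : ℝ) - (k + 1 : ℕ)) * damping n (2 * n * ρ) (k + 1)) / n
      = (1 + 2 * ρ) * damping n (2 * n * ρ) (k + 1) := by
    rw [damping_succ hk hc]
    field_simp
    ring
  rw [e, ← mul_assoc]
  exact le_mul_of_one_le_left hpos (by nlinarith)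

/-- The rewards are fixed backwards from the constraints: `α = β/κ` makes the potential under `OI`
nonnegative, and `γ = 2nα/(d₁κ)` gives equality at the local optimum. At the valley bottom a factor
4 in `M` would pay for `γ` alone; 6 leaves `nβ/(d₁κ²) ≥ β` for the extra `β`. -/
theorem IsSeqOptTwo.expectedRuntime_le {n : ℕ} [NeZero n] {d₁ d₂ : ℕ} {f : BitString n → ℝ}
    (hf : IsSeqOptTwo d₁ d₂ f) (hd₂ : 0 < d₂) (hd : d₂ < d₁) (hd₁ : d₁ < n) (p q : I)
    (hp0 : 0 < (p : ℝ)) (hq0 : 0 < (q : ℝ)) {ρ κ : ℝ} (hp : (p : ℝ) ≤ ρ) (hq : (q : ℝ) ≤ ρ)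
    (hρ : ρ ≤ 1 / 2) (hκ0 : 0 < κ) (hκ : κ ≤ Real.exp (-(2 * n * ρ * (1 + Real.log n)))) :
    expectedRuntime p q f ≤
      ENNReal.ofReal (6 * (n : ℝ) ^ 2 * (1 / (p : ℝ) + 1 / (q : ℝ)) / (d₁ * d₂ * κ ^ 3)) := by
  have hn : (0 : ℝ) < n := by simp [NeZero.pos n]
  have hρ0 : 0 ≤ ρ := hp0.le.trans hp
  have hc : 0 ≤ 2 * n * ρ := by positivity
  have hD₂ : (0 : ℝ) < d₂ := by exact_mod_cast hd₂
  have hD₁ : (0 : ℝ) < d₁ := by exact_mod_cast hd₂.trans hd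
  have hD₁n : (d₁ : ℝ) ≤ n := by exact_mod_cast hd₁.le
  have hD₂n : (d₂ : ℝ) ≤ n := by exact_mod_cast (hd.trans hd₁).le
  have hκA := fun h => hκ.trans (exp_le_damping n hc h)
  have hκ1 : κ ≤ 1 := (hκA 0).trans (damping_le_one n hc 0)
  obtain ⟨β, hβ⟩ : ∃ β, β = 1 / (p : ℝ) + 1 / (q : ℝ) := ⟨_, rfl⟩
  have hβ0 : 0 < β := by rw [hβ]; positivity
  rw [← hβ]
  have h1 : β / κ ≤ 2 * n * β / (d₁ * κ ^ 2) := by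
    rw [div_le_div_iff₀ hκ0 (by positivity)]
    have : d₁ * κ ≤ 2 * n := by nlinarith
    nlinarith [mul_le_mul_of_nonneg_left this (by positivity : 0 ≤ β * κ)]
  have h2 : 2 * n * β / (d₁ * κ ^ 2) + β ≤
      1 / 2 * (d₂ / n * (6 * (n : ℝ) ^ 2 * β / (d₁ * d₂ * κ ^ 3) * κ)) := by
    have e : 1 / 2 * (d₂ / n * (6 * (n : ℝ) ^ 2 * β / (d₁ * d₂ * κ ^ 3) * κ))
        = 2 * n * β / (d₁ * κ ^ 2) + n * β / (d₁ * κ ^ 2) := by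
      field_simp
      ring
    rw [e]
    gcongr
    rw [le_div_iff₀ (by positivity)]
    have : d₁ * κ ^ 2 ≤ n := by nlinarith [mul_le_one₀ hκ1 hκ0.le hκ1]
    nlinarith
  have hM : 0 ≤ 6 * (n : ℝ) ^ 2 * β / (d₁ * d₂ * κ ^ 3) := by positivity
  have h3 : 2 * n * β / (d₁ * κ ^ 2) ≤ 6 * (n : ℝ) ^ 2 * β / (d₁ * d₂ * κ ^ 3) := by
    have h4 : d₂ / n * (6 * (n : ℝ) ^ 2 * β / (d₁ * d₂ * κ ^ 3) * κ)
        ≤ 6 * (n : ℝ) ^ 2 * β / (d₁ * d₂ * κ ^ 3) :=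
      (mul_le_of_le_one_left (by positivity) ((div_le_one hn).2 hD₂n)).trans
        (mul_le_of_le_one_right hM hκ1)
    linarith
  refine expectedRuntime_le_of_damping hf hd₂ hd hd₁ p q hp0 (hp.trans hρ) hq0 (hq.trans hρ)
    (α := β / κ) (γ := 2 * n * β / (d₁ * κ ^ 2)) hβ hκ0.le hκA
    (fun h => damping_le_one n hc h) (fun r hr k hk => damping_drift hk ?_ hρ0 hρ)
    (by positivity) (by field_simp; rfl) h1 h3 (le_of_eq ?_) h2
  · rcases hr with rfl | rfl <;> assumption
  · field_simp

/-! ### The benchmarks -/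

lemma ones_of_mem_layer {n h : ℕ} {x : BitString n} (hx : x ∈ layer n h) : ones x + h = n := by
  have h1 := ones_add_hammingDist x
  rwa [show hammingDist x (allOnes n) = h from hx] at h1

lemma ones_allOnes (n : ℕ) : ones (allOnes n) = n := by simp [ones, allOnes]

lemma ones_lt {n : ℕ} {x : BitString n} (hx : x ≠ allOnes n) : ones x < n := by
  have h1 := ones_add_hammingDist x
  have h2 := hammingDist_pos.2 hx
  omega

lemma isSeqOptTwo_jump {n m : ℕ} (hm : 2 ≤ m) (hmn : 2 * m ≤ n) :
    IsSeqOptTwo m 1 (jump n m) where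
  unique_max x hx := by
    have h1 := ones_lt hx
    have h1' : (ones x : ℝ) + 1 ≤ n := by exact_mod_cast h1
    have hm' : (2 : ℝ) ≤ m := by exact_mod_cast hm
    simp only [jump, ones_allOnes, or_true, if_true]
    split_ifs <;> linarith [(ones x).cast_nonneg (α := ℝ)]
  first_ascent h hh hn x hx y hy := by
    have hx' := ones_of_mem_layer hx
    have hy' := ones_of_mem_layer hy
    have hxy : (ones x : ℝ) = ones y + 1 := by exact_mod_cast (by omega)
    unfold jump
    split_ifs <;> first | omega | linarith
  descent h hh hn x hx y hy := by
    have hx' := ones_of_mem_layer hx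
    have hy' := ones_of_mem_layer hy
    have hxy : (ones x : ℝ) = ones y + 1 := by exact_mod_cast (by omega)
    unfold jump
    split_ifs
    any_goals first | omega | linarith
    -- What remains is the edge at the local optimum, where `y` has exactly `n - m` ones.
    have h1 : (n : ℝ) ≤ m + ones y := by exact_mod_cast (by omega)
    have h2 : (1 : ℝ) ≤ ones y := by exact_mod_cast (by omega)
    linarith
  second_ascent h hh x hx y hy := by
    have hx' := ones_of_mem_layer hx
    have hy' := ones_of_mem_layer hy
    have hxy : (ones x : ℝ) = ones y + 1 := by exact_mod_cast (by omega)
    have hm' : (2 : ℝ) ≤ m := by exact_mod_cast hm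
    have hxn : (ones x : ℝ) = n := by exact_mod_cast (by omega)
    unfold jump
    split_ifs <;> first | omega | linarith [(ones x).cast_nonneg (α := ℝ)]

lemma isSeqOptTwo_cliff {n d : ℕ} (hd : 2 ≤ d) :
    IsSeqOptTwo d (d - 1) (cliff n d) where
  unique_max x hx := by
    have h1 := ones_lt hx
    have h1' : (ones x : ℝ) + 1 ≤ n := by exact_mod_cast h1
    simp only [cliff, ones_allOnes]
    split_ifs with h2
    any_goals first | omega | linarith
    have h2' : (ones x : ℝ) + d ≤ n := by exact_mod_cast h2
    linarith
  first_ascent h hh hn x hx y hy := by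
    have hx' := ones_of_mem_layer hx
    have hy' := ones_of_mem_layer hy
    have hxy : (ones x : ℝ) = ones y + 1 := by exact_mod_cast (by omega)
    unfold cliff
    split_ifs <;> first | omega | linarith
  descent h hh hn x hx y hy := by
    have hx' := ones_of_mem_layer hx
    have hy' := ones_of_mem_layer hy
    have hxy : (ones x : ℝ) = ones y + 1 := by exact_mod_cast (by omega)
    have hd' : (2 : ℝ) ≤ d := by exact_mod_cast hd
    unfold cliff
    split_ifs <;> first | omega | linarith
  second_ascent h hh x hx y hy := by
    have hx' := ones_of_mem_layer hx
    have hy' := ones_of_mem_layer hy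
    have hxy : (ones x : ℝ) = ones y + 1 := by exact_mod_cast (by omega)
    unfold cliff
    split_ifs <;> first | omega | linarith

lemma isSeqOptTwo_cliffJump {n d r s : ℕ} (hr : 1 ≤ r) (hrd : r < d)
    (hs : 1 ≤ s) : IsSeqOptTwo d (d - r) (cliffJump n d r s) where
  unique_max x hx := by
    have h1 := ones_lt hx
    have h1' : (ones x : ℝ) + 1 ≤ n := by exact_mod_cast h1
    have hd' : (2 : ℝ) ≤ d := by exact_mod_cast (by omega)
    simp only [cliffJump, ones_allOnes]
    split_ifs with h2 h3
    any_goals first | omega | linarith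
    · have h2' : (ones x : ℝ) + d ≤ n := by exact_mod_cast h2
      linarith
    · have h2' : (n : ℝ) + 1 ≤ ones x + d := by exact_mod_cast (by omega)
      have := mul_nonneg (s.cast_nonneg (α := ℝ)) (sub_nonneg.2 h2')
      linarith
  first_ascent h hh hn x hx y hy := by
    have hx' := ones_of_mem_layer hx
    have hy' := ones_of_mem_layer hy
    have hxy : (ones x : ℝ) = ones y + 1 := by exact_mod_cast (by omega)
    unfold cliffJump
    split_ifs <;> first | omega | linarith
  descent h hh hn x hx y hy := by
    have hx' := ones_of_mem_layer hx
    have hy' := ones_of_mem_layer hy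
    have hxy : (ones x : ℝ) = ones y + 1 := by exact_mod_cast (by omega)
    have hs' : (1 : ℝ) ≤ s := by exact_mod_cast hs
    have hd' : (2 : ℝ) ≤ d := by exact_mod_cast (by omega)
    unfold cliffJump
    split_ifs
    any_goals first | omega | linarith
    -- The edge over the cliff, where `y` is a local optimum; the drop is `d - 3/2 > 0`.
    · have h2 : (ones y : ℝ) = n - d := by
        rw [eq_sub_iff_add_eq]; exact_mod_cast (by omega)
      rw [hxy, h2]
      linarith
    · rw [hxy]
      linarith
  second_ascent h hh x hx y hy := by
    have hx' := ones_of_mem_layer hx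
    have hy' := ones_of_mem_layer hy
    have hxy : (ones x : ℝ) = ones y + 1 := by exact_mod_cast (by omega)
    unfold cliffJump
    split_ifs
    any_goals first | omega | linarith
    -- Here `y` lies at the valley bottom and `x` on the second slope; the slope term only lowers
    -- the fitness of `y`.
    have h2' : (n : ℝ) + 1 ≤ ones y + d := by exact_mod_cast (by omega)
    have := mul_nonneg (s.cast_nonneg (α := ℝ)) (sub_nonneg.2 h2')
    linarith

/-! ### The constants -/

theorem exists_forall_isSeqOptTwo_expectedRuntime_le (p q : ℕ → I)
    (hp : ∀ n, 0 < p n) (hq : ∀ n, 0 < q n)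
    (hpΘ : (fun n => (p n : ℝ)) =Θ[atTop] fun n => 1 / ((n : ℝ) * Real.log n))
    (hqΘ : (fun n => (q n : ℝ)) =Θ[atTop] fun n => 1 / ((n : ℝ) * Real.log n)) :
    ∃ C : ℝ, 0 < C ∧ ∃ N : ℕ, ∀ (n : ℕ) [NeZero n], N ≤ n → ∀ (d₁ d₂ : ℕ) (f : BitString n → ℝ),
      0 < d₂ → d₂ < d₁ → d₁ < n → IsSeqOptTwo d₁ d₂ f →
        expectedRuntime (p n) (q n) f
          ≤ ENNReal.ofReal (C * ((n : ℝ) ^ 3 / (d₁ * d₂) * Real.log n)) := by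
  obtain ⟨a, ha, hpa⟩ := hpΘ.1.exists_pos
  obtain ⟨b, hb, hqb⟩ := hqΘ.1.exists_pos
  obtain ⟨a', ha', hpa'⟩ := hpΘ.2.exists_pos
  obtain ⟨b', hb', hqb'⟩ := hqΘ.2.exists_pos
  have hlog : Tendsto (fun n : ℕ => Real.log n) atTop atTop :=
    Real.tendsto_log_atTop.comp tendsto_natCast_atTop_atTop
  have hnlog : Tendsto (fun n : ℕ => (n : ℝ) * Real.log n) atTop atTop :=
    tendsto_natCast_atTop_atTop.atTop_mul_atTop₀ hlog
  set c := max a b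
  have hc0 : 0 < c := lt_max_of_lt_left ha
  -- With `ρ = c / (n log n)`, the condition `n log n ≥ 2c` gives `ρ ≤ 1/2`, and `log n ≥ 1` gives
  -- `2nρ(1 + log n) ≤ 4c`, whence the choice of `κ`.
  obtain ⟨N, hN⟩ := eventually_atTop.1 (((((hpa.bound.and hqb.bound).and hpa'.bound).and
    hqb'.bound).and (hlog.eventually_ge_atTop 1)).and (hnlog.eventually_ge_atTop (2 * c)))
  set κ := Real.exp (-(4 * c))
  have hκ0 : 0 < κ := Real.exp_pos _
  refine ⟨6 * (a' + b') / κ ^ 3, by positivity, N, fun n _ hn d₁ d₂ f hd₂ hd hd₁ hf => ?_⟩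
  obtain ⟨⟨⟨⟨⟨h1, h2⟩, h3⟩, h4⟩, h5⟩, h6⟩ := hN n hn
  have hn0 : (0 : ℝ) < n := by simp [NeZero.pos n]
  have hL : 0 < Real.log n := by linarith
  have hp0 : 0 < (p n : ℝ) := hp n
  have hq0 : 0 < (q n : ℝ) := hq n
  have hx : 0 < (n : ℝ) * Real.log n := by positivity
  rw [Real.norm_of_nonneg hp0.le, Real.norm_of_nonneg (by positivity)] at h1 h3
  rw [Real.norm_of_nonneg hq0.le, Real.norm_of_nonneg (by positivity)] at h2 h4
  have hpi : 1 / (p n : ℝ) ≤ a' * (n * Real.log n) := by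
    rw [div_le_iff₀ hx] at h3
    rw [div_le_iff₀ hp0]
    linarith
  have hqi : 1 / (q n : ℝ) ≤ b' * (n * Real.log n) := by
    rw [div_le_iff₀ hx] at h4
    rw [div_le_iff₀ hq0]
    linarith
  have hD₂ : (0 : ℝ) < d₂ := by exact_mod_cast hd₂
  have hD₁ : (0 : ℝ) < d₁ := by exact_mod_cast hd₂.trans hd
  refine (hf.expectedRuntime_le hd₂ hd hd₁ (p n) (q n) hp0 hq0
    (ρ := c * (1 / (n * Real.log n))) (κ := κ) ?_ ?_ ?_ hκ0 ?_).trans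
    (ENNReal.ofReal_le_ofReal ?_)
  · exact h1.trans (by gcongr; exact le_max_left a b)
  · exact h2.trans (by gcongr; exact le_max_right a b)
  · rw [mul_one_div, div_le_iff₀ hx]
    linarith
  · refine Real.exp_le_exp.2 (neg_le_neg ?_)
    have e : 2 * n * (c * (1 / (n * Real.log n))) * (1 + Real.log n)
        = 2 * c * (1 + Real.log n) / Real.log n := by
      field_simp
    rw [e, div_le_iff₀ hL]
    nlinarith
  · calc 6 * (n : ℝ) ^ 2 * (1 / (p n : ℝ) + 1 / (q n : ℝ)) / (d₁ * d₂ * κ ^ 3)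
        ≤ 6 * (n : ℝ) ^ 2 * (a' * (n * Real.log n) + b' * (n * Real.log n))
            / (d₁ * d₂ * κ ^ 3) := by gcongr
      _ = _ := by
        field_simp

end MMAHH

/-! ### The benchmark bounds from the one on `SEQOPT₂`. -/

theorem mainTheorem3 (p q : ℕ → unitInterval)
    (hp : ∀ n, 0 < p n ∧ p n < 1) (hq : ∀ n, 0 < q n ∧ q n < 1)
    (hpΘ : (fun n => (p n : ℝ)) =Θ[atTop] fun n => 1 / ((n : ℝ) * Real.log n))
    (hqΘ : (fun n => (q n : ℝ)) =Θ[atTop] fun n => 1 / ((n : ℝ) * Real.log n)) :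
    ∃ C : ℝ, 0 < C ∧ ∃ N : ℕ, ∀ (n : ℕ) [NeZero n], N ≤ n →
      (∀ m : ℕ, 2 ≤ m → 2 * m ≤ n →
        MMAHH.expectedRuntime (p n) (q n) (MMAHH.jump n m)
          ≤ ENNReal.ofReal (C * ((n : ℝ) ^ 3 / m * Real.log n))) ∧
      (∀ d : ℕ, 2 ≤ d → 2 * d ≤ n →
        MMAHH.expectedRuntime (p n) (q n) (MMAHH.cliff n d)
          ≤ ENNReal.ofReal (C * ((n : ℝ) ^ 3 / (d : ℝ) ^ 2 * Real.log n))) ∧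
      (∀ d r : ℕ, 1 ≤ r → r < d → 2 * d ≤ n →
        (∀ s : ℕ, 1 ≤ s →
          MMAHH.expectedRuntime (p n) (q n) (MMAHH.cliffJump n d r s)
            ≤ ENNReal.ofReal (C * ((n : ℝ) ^ 3 / ((d : ℝ) * ((d : ℝ) - r)) * Real.log n))) ∧
        (∀ f : MMAHH.BitString n → ℝ, MMAHH.IsSeqOptTwo d (d - r) f →
          MMAHH.expectedRuntime (p n) (q n) f
            ≤ ENNReal.ofReal (C * ((n : ℝ) ^ 3 / ((d : ℝ) * ((d : ℝ) - r)) * Real.log n)))) := by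
  obtain ⟨C, hC, N, H⟩ := MMAHH.exists_forall_isSeqOptTwo_expectedRuntime_le p q
    (fun n => (hp n).1) (fun n => (hq n).1) hpΘ hqΘ
  -- The factor 2 is needed for Cliff alone: its valley bottom is layer `d - 1`, and `d ≤ 2(d - 1)`.
  refine ⟨2 * C, by positivity, N, fun n _ hn => ⟨fun m hm hmn => ?_, fun d hd hdn => ?_,
    fun d r hr hrd hdn => ?_⟩⟩
  · have hlog := Real.log_natCast_nonneg n
    refine (H n hn m 1 _ one_pos hm (by omega) (MMAHH.isSeqOptTwo_jump hm hmn)).trans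
      (ENNReal.ofReal_le_ofReal ?_)
    rw [Nat.cast_one, mul_one]
    gcongr
    linarith
  · have hlog := Real.log_natCast_nonneg n
    have hd' : (2 : ℝ) ≤ d := by exact_mod_cast hd
    refine (H n hn d (d - 1) _ (by omega) (by omega) (by omega)
      (MMAHH.isSeqOptTwo_cliff hd)).trans (ENNReal.ofReal_le_ofReal ?_)
    rw [Nat.cast_sub (by omega), Nat.cast_one]
    have h1 : (n : ℝ) ^ 3 / (d * (d - 1)) ≤ 2 * ((n : ℝ) ^ 3 / (d : ℝ) ^ 2) := by
      rw [← mul_div_assoc, div_le_div_iff₀ (by nlinarith) (by positivity)]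
      have h2 : (d : ℝ) ^ 2 ≤ 2 * (d * (d - 1)) := by nlinarith
      nlinarith [mul_le_mul_of_nonneg_left h2 (by positivity : 0 ≤ (n : ℝ) ^ 3)]
    calc C * ((n : ℝ) ^ 3 / (d * (d - 1)) * Real.log n)
        ≤ C * (2 * ((n : ℝ) ^ 3 / (d : ℝ) ^ 2) * Real.log n) := by gcongr
      _ = _ := by ring
  · have key (f : MMAHH.BitString n → ℝ) (hf : MMAHH.IsSeqOptTwo d (d - r) f) :
        MMAHH.expectedRuntime (p n) (q n) f
          ≤ ENNReal.ofReal (2 * C * ((n : ℝ) ^ 3 / ((d : ℝ) * ((d : ℝ) - r)) * Real.log n)) := by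
      have hlog := Real.log_natCast_nonneg n
      have hrd' : (0 : ℝ) ≤ d - r := sub_nonneg.2 (by exact_mod_cast hrd.le)
      refine (H n hn d (d - r) f (by omega) (by omega) (by omega) hf).trans
        (ENNReal.ofReal_le_ofReal ?_)
      rw [Nat.cast_sub hrd.le]
      gcongr
      linarith
    exact ⟨fun s hs => key _ (MMAHH.isSeqOptTwo_cliffJump hr hrd hs), key⟩
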